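/- A weighted automaton over a finite nonempty alphabet $\Sigma$ is a tuple $A=(Q,q_I,\Sigma,\delta,\gamma)$ where $Q$ is a finite set of states, $q_I\in Q$, $\delta\subseteq Q\times\Sigma\times Q$ is a transition relation that is total (for all $q\in Q$, $\sigma\in\Sigma$ there is $q'$ with $(q,\sigma,q')\in\delta$), and $\gamma:\delta\to\mathbb{Q}$ is a weight function. A run of $A$ over an infinite word $w=\sigma_1\sigma_2\cdots\in\Sigma^\omega$ is a sequence $r = q_0\sigma_1q_1\sigma_2\cdots$ with $q_0=q_I$ and $(q_i,\sigma_{i+1},q_{i+1})\in\delta$ for all $i\ge 0$. Viewed as a nondeterministic $\mathsf{LimSup}$-automaton, $A$ defines the quantitative language $L_A:\Sigma^\omega\to\mathbb{R}$, $$L_A(w)=\sup\Big\{\limsup_{i\to\infty}\gamma(q_i,\sigma_{i+1},q_{i+1}) \;\Big|\; q_0\sigma_1q_1\sigma_2\cdots \text{ is a run of } A \text{ over } w\Big\}.$$ \textbf{Theorem.} Nondeterministic $\mathsf{LimSup}$-automata are closed under complement, with cost $O(m\cdot 2^{n\log n})$. That is, there is an absolute constant $C$ such that for every finite nonempty alphabet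 $\Sigma$ and every nondeterministic $\mathsf{LimSup}$-automaton $A$ over $\Sigma$ with $n$ states and $m$ transitions, there is a nondeterministic $\mathsf{LimSup}$-automaton $B$ over $\Sigma$ with $$L_B(w)=1-L_A(w)\quad\text{for all } w\in\Sigma^\omega,$$ and with at most $C\cdot m\cdot 2^{n\log_2 n}$ states. -/

import Mathlib

open Filter

universe u v

/-- A (nondeterministic) weighted automaton over the alphabet `α`: a finite set of states with an
initial state, a total transition relation, and a rational weight on every transition. -/
structure WeightedAutomaton (α : Type u) where
  State : Type v
  finite_state : Finite State
  init : State
  /-- the set of transitions -/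
  δ : Set (State × α × State)
  total : ∀ (q : State) (a : α), ∃ q' : State, (q, a, q') ∈ δ
  /-- the weight function, defined on transitions only -/
  γ : δ → ℚ

/-- Quantitative languages over infinite words; the word `σ₁σ₂…` is `w` with `w i = σᵢ₊₁`. -/
abbrev QuantitativeLanguage (α : Type u) := (ℕ → α) → ℝ

/-- The complement `1 - L` of a quantitative language. -/
def QuantitativeLanguage.complement {α : Type u} (L : QuantitativeLanguage α) :
    QuantitativeLanguage α :=
  fun w => 1 - L w

/-- The value function `LimSup`. -/
noncomputable def limSupValue (x : ℕ → ℚ) : ℝ :=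
  limsup (fun i => (x i : ℝ)) atTop

namespace WeightedAutomaton

variable {α : Type u} (A : WeightedAutomaton.{u, v} α)

/-- The number of states. -/
noncomputable def numStates : ℕ := Nat.card A.State

/-- The number of transitions. -/
noncomputable def numTransitions : ℕ := Nat.card A.δ

/-- `r` is the sequence of states of a run of `A` over the infinite word `w`. -/
def IsRun (w : ℕ → α) (r : ℕ → A.State) : Prop :=
  r 0 = A.init ∧ ∀ i, (r i, w i, r (i + 1)) ∈ A.δ

/-- The sequence of weights along a run. -/
def runWeights {w : ℕ → α} {r : ℕ → A.State} (h : A.IsRun w r) : ℕ → ℚ :=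
  fun i => A.γ ⟨(r i, w i, r (i + 1)), h.2 i⟩

/-- The values of all runs of `A` over `w`, for the value function `Val`. -/
def runValues (Val : (ℕ → ℚ) → ℝ) (w : ℕ → α) : Set ℝ :=
  {x | ∃ (r : ℕ → A.State) (h : A.IsRun w r), x = Val (A.runWeights h)}

/-- The quantitative language defined by the `Val`-automaton `A`. -/
noncomputable def language (Val : (ℕ → ℚ) → ℝ) : QuantitativeLanguage α :=
  fun w => sSup (A.runValues Val w)

/-- Since `A` is total, every word has a run. -/
theorem exists_isRun (w : ℕ → α) : ∃ r, A.IsRun w r := by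
  choose next hnext using A.total
  exact ⟨fun i => Nat.rec A.init (fun i q => next q (w i)) i, rfl, fun i => hnext _ _⟩

/-- The supremum defining the language of a `LimSup`-automaton over a finite alphabet is the
supremum of a nonempty bounded set. -/
theorem isLUB_language_limSup [Finite α] (w : ℕ → α) :
    IsLUB (A.runValues limSupValue w) (A.language limSupValue w) := by
  obtain ⟨r, hr⟩ := A.exists_isRun w
  refine isLUB_csSup ⟨_, r, hr, rfl⟩ ?_
  have := A.finite_state
  obtain ⟨b, hb⟩ := (Set.finite_range fun t => (A.γ t : ℝ)).bddAbove
  obtain ⟨c, hc⟩ := (Set.finite_range fun t => (A.γ t : ℝ)).bddBelow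
  refine ⟨b, ?_⟩
  rintro _ ⟨r, h, rfl⟩
  exact limsup_le_of_le
    (isCoboundedUnder_le_of_le atTop (x := c) fun i => hc ⟨_, rfl⟩)
    (Eventually.of_forall fun i => hb ⟨_, rfl⟩)

end WeightedAutomaton

/-! Since there are finitely many weights, `L_A(w)` is the least weight `v` such that no run over
`w` has infinitely many weights above `v`. The automaton `B` guesses `v` and certifies that bound;
this is Büchi complementation of the run graph whose accepting edges are those of weight above `v`.

The certificate is a ranking of every level: ranks never increase along edges and odd ranks drop
across accepting edges, so along each path the rank settles. A set `O` of even-ranked vertices,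
refilled whenever it is empty and empty infinitely often, rules out even limits; an odd limit
forbids further accepting edges (`eventually_not_acc_of_tightStep`). Conversely, alternately
deleting the vertices with only bounded paths and those leading to no accepting edge yields such a
ranking, tight from some level on (`exists_tightStep`). So `B` tracks a superset of the reachable
states, guesses when to switch to tight rankings, and earns `1 - v` on steps within that phase taken
with `O` empty. All other steps earn `1 - top`, where `top` is the largest weight of `A`; this never
exceeds `1 - L_A(w)`.

The pairs (tight ranking, `O`) are counted as by exponential generating functions: each pair of
ranks `2j, 2j+1` contributes `g = e^x * e^x * (e^x - 1)`, for even rank outside `O`, even rank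
inside `O`, and the nonempty odd rank. Hence at most `g^k * n! / x^n` of them have `k` odd ranks. At
`x = 3/8` one has `g < 1`, so the sum over `k` converges, and `x > 1/e`, so `n! / x^n = O(n^n)`.
Guessing `v` costs the factor `m`. -/

/-! ### Counting tight rankings -/

section Counting

variable {Q : Type v} {β : Type*}

/-- A partial ranking with ranks below `2 * k` that takes all `k` odd ranks, together with a set of
vertices of even rank. Unranked vertices have the value `⊤`. -/
def IsTightRanking (k : ℕ) (p : (Q → ℕ∞) × Finset Q) : Prop :=
  (∀ q, p.1 q = ⊤ ∨ p.1 q < (2 * k : ℕ)) ∧ (∀ j < k, ∃ q, p.1 q = (2 * j + 1 : ℕ)) ∧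
    ∀ q ∈ p.2, ∃ j : ℕ, p.1 q = (2 * j : ℕ)

/-- Tight rankings with `k` odd ranks such that the vertices outside of `S` are unranked. -/
def tightRankings (k : ℕ) (S : Finset Q) : Set ((Q → ℕ∞) × Finset Q) :=
  {p | (∀ q, q ∉ S → p.1 q = ⊤) ∧ IsTightRanking k p}

theorem tightRankings_zero_subset (S : Finset Q) :
    tightRankings 0 S ⊆ {(fun _ => ⊤, ∅)} := by
  rintro ⟨f, O⟩ ⟨-, h2, -, h4⟩
  have hf : f = fun _ => ⊤ := by
    funext q
    simpa using h2 q
  subst hf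
  have hO : O = ∅ := by
    refine Finset.eq_empty_of_forall_notMem fun q hq => ?_
    obtain ⟨j, hj⟩ := h4 q hq
    exact absurd hj.symm (ENat.natCast_ne_top _)
  simp [hO]

variable [DecidableEq Q]

/-- A subset of `S` with at least `b` elements, together with an element of the set that `X`
associates with the rest of `S`. -/
def peel (b : ℕ) (X : Finset Q → Set β) (S : Finset Q) : Set (Finset Q × β) :=
  {p | p.1 ⊆ S ∧ b ≤ p.1.card ∧ p.2 ∈ X (S \ p.1)}

/-- The bound `#(X S) ≤ c * |S|! / x ^ |S|` on the members of a family of finite sets. -/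
def FactorialBound (x c : ℝ) (X : Finset Q → Set β) : Prop :=
  ∀ S, (X S).Finite ∧ ((X S).ncard : ℝ) ≤ c * (S.card.factorial / x ^ S.card)

/-- This is the product rule for exponential generating functions: choosing `j` of `n` vertices
turns `(n-j)! / x^(n-j)` into `(n! / x^n) * (x^j / j!)`, and `y` bounds the sum of the last factors.
-/
theorem FactorialBound.peel {x c y : ℝ} (hx : 0 < x) (hc : 0 ≤ c) {b : ℕ}
    (hy : ∀ n : ℕ, ∑ j ∈ Finset.Ico b (n + 1), x ^ j / j.factorial ≤ y)
    {X : Finset Q → Set β} (hX : FactorialBound x c X) :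
    FactorialBound x (c * y) (peel b X) := by
  intro S
  have hsub : _root_.peel b X S =
      ⋃ T ∈ S.powerset.filter (fun T => b ≤ T.card), Prod.mk T '' X (S \ T) := by
    ext ⟨T, z⟩
    simp only [_root_.peel, Set.mem_ofPred_eq, Finset.mem_filter, Finset.mem_powerset,
      Set.mem_iUnion, Set.mem_image, Prod.mk.injEq, exists_prop]
    constructor
    · rintro ⟨h1, h2, h3⟩
      exact ⟨T, ⟨h1, h2⟩, z, h3, rfl, rfl⟩
    · rintro ⟨_, ⟨h1, h2⟩, _, h3, rfl, rfl⟩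
      exact ⟨h1, h2, h3⟩
  have hfin : ∀ T, (Prod.mk T '' X (S \ T)).Finite := fun T => (hX _).1.image _
  refine ⟨hsub ▸ Set.Finite.biUnion (Finset.finite_toSet _) fun T _ => hfin T, ?_⟩
  have h1 : (_root_.peel b X S).ncard ≤
      ∑ T ∈ S.powerset.filter (fun T => b ≤ T.card), (X (S \ T)).ncard := by
    rw [hsub]
    refine (Finset.set_ncard_biUnion_le _ _).trans (Finset.sum_le_sum fun T _ => ?_)
    exact Set.ncard_image_le (hX _).1
  set n := S.card with hn
  have h2 : ((_root_.peel b X S).ncard : ℝ) ≤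
      ∑ T ∈ S.powerset.filter (fun T => b ≤ T.card),
        c * ((n - T.card).factorial / x ^ (n - T.card)) := by
    refine (Nat.cast_le.mpr h1).trans ?_
    push_cast
    refine Finset.sum_le_sum fun T hT => ?_
    have hT' : T ⊆ S := by simpa using (Finset.mem_filter.mp hT).1
    have := (hX (S \ T)).2
    rwa [Finset.card_sdiff_of_subset hT'] at this
  refine h2.trans ?_
  rw [Finset.sum_filter, Finset.sum_powerset_apply_card
    (fun j => if b ≤ j then c * (((n - j).factorial : ℝ) / x ^ (n - j)) else 0)]
  have h3 : ∀ j ∈ Finset.range (n + 1),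
      n.choose j • (if b ≤ j then c * (((n - j).factorial : ℝ) / x ^ (n - j)) else 0) =
      c * (n.factorial / x ^ n) * (if b ≤ j then x ^ j / j.factorial else 0) := by
    intro j hj
    have hj' : j ≤ n := by simpa [Nat.lt_succ_iff] using hj
    split_ifs
    · have e1 : (n.choose j : ℝ) * j.factorial * (n - j).factorial = n.factorial := by
        exact_mod_cast Nat.choose_mul_factorial_mul_factorial hj'
      have e2 : x ^ n = x ^ j * x ^ (n - j) := by rw [← pow_add, Nat.add_sub_cancel' hj']
      rw [← e1, e2, nsmul_eq_mul]
      field_simp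
    · simp
  rw [Finset.sum_congr rfl h3, ← Finset.mul_sum, ← Finset.sum_filter]
  have h4 : (Finset.range (n + 1)).filter (fun j => b ≤ j) = Finset.Ico b (n + 1) := by
    ext j; simp [and_comm]
  rw [h4]
  have : 0 ≤ c * (n.factorial / x ^ n) := by positivity
  calc _ ≤ c * (n.factorial / x ^ n) * y := mul_le_mul_of_nonneg_left (hy n) this
    _ = _ := by ring

/-- Adjoin two sets of vertices of rank `0` and a set of vertices of rank `1` below a ranking. -/
def pushRanks (p : Finset Q × Finset Q × Finset Q × (Q → ℕ∞) × Finset Q) :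
    (Q → ℕ∞) × Finset Q :=
  (fun q => if q ∈ p.1 ∪ p.2.1 then 0 else if q ∈ p.2.2.1 then 1 else p.2.2.2.1 q + 2,
    p.2.1 ∪ p.2.2.2.2)

/-- Removing ranks 0 and 1 and lowering the others by two leaves a tight ranking with one odd rank
fewer. The innermost `peel` has bound 1 because rank 1 must occur. -/
theorem tightRankings_succ_subset [Finite Q] (k : ℕ) (S : Finset Q) :
    tightRankings (k + 1) S ⊆
      pushRanks '' peel 0 (peel 0 (peel 1 (tightRankings k))) S := by
  classical
  have := Fintype.ofFinite Q
  rintro ⟨f, O⟩ ⟨h1, h2, h3, h4⟩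
  simp only at h1 h2 h3 h4
  have hS : ∀ q (n : ℕ), f q = n → q ∈ S := fun q n hq => by
    by_contra hqS
    exact ENat.natCast_ne_top n (hq.symm.trans (h1 q hqS))
  refine ⟨(Finset.univ.filter fun q => f q = 0 ∧ q ∉ O,
    Finset.univ.filter fun q => f q = 0 ∧ q ∈ O,
    Finset.univ.filter fun q => f q = 1,
    -- Peeled vertices lie outside the remaining set and must become unranked; `⊤ - 2 = ⊤` keeps the
    -- others unranked.
    (fun q => if f q = 0 ∨ f q = 1 then ⊤ else f q - 2), O.filter fun q => f q ≠ 0), ?_, ?_⟩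
  · refine ⟨fun q hq => hS q 0 (by simpa using (Finset.mem_filter.mp hq).2.1), Nat.zero_le _,
      fun q hq => ?_, Nat.zero_le _, fun q hq => ?_, ?_, ?_, ?_, ?_, ?_⟩
    · simp only [Finset.mem_filter, Finset.mem_univ, true_and, Finset.mem_sdiff] at hq ⊢
      exact ⟨hS q 0 (by simpa using hq.1), fun h => h.2 hq.2⟩
    · simp only [Finset.mem_filter, Finset.mem_univ, true_and, Finset.mem_sdiff] at hq ⊢
      refine ⟨⟨hS q 1 (by simpa using hq), ?_⟩, ?_⟩ <;> simp [hq]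
    · obtain ⟨q, hq⟩ := h3 0 (Nat.succ_pos k)
      exact Finset.card_pos.mpr ⟨q, by simpa using hq⟩
    · intro q hq
      simp only
      split_ifs with h
      · rfl
      · push Not at h
        have : q ∉ S := by
          intro hqS
          apply hq
          simp [hqS, h.1, h.2]
        rw [h1 q this]
        rfl
    · intro q
      simp only
      split_ifs with h
      · exact Or.inl rfl
      · rcases h2 q with h' | h'
        · left; rw [h']; rfl
        · right
          obtain ⟨n, hn⟩ := ENat.ne_top_iff_exists.mp (ne_top_of_lt h')
          rw [← hn] at h h' ⊢
          norm_cast at h h' ⊢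
          omega
    · intro j hj
      obtain ⟨q, hq⟩ := h3 (j + 1) (by omega)
      refine ⟨q, ?_⟩
      simp only [hq]
      rw [if_neg (by
        exact_mod_cast (show ¬ (2 * (j + 1) + 1 = 0 ∨ 2 * (j + 1) + 1 = 1) by omega))]
      norm_cast
    · intro q hq
      obtain ⟨hqO, hq0⟩ := Finset.mem_filter.mp hq
      obtain ⟨j, hj⟩ := h4 q hqO
      refine ⟨j - 1, ?_⟩
      simp only [hj] at hq0 ⊢
      rw [if_neg (by norm_cast at hq0 ⊢; omega)]
      norm_cast
      omega
  · simp only [pushRanks, Prod.mk.injEq]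
    constructor
    · funext q
      by_cases h0 : f q = 0
      · by_cases hO : q ∈ O <;> simp [h0, hO]
      · by_cases h1' : f q = 1
        · simp [h1']
        · rcases h2 q with h' | h'
          · simp [h']
          · obtain ⟨n, hn⟩ := ENat.ne_top_iff_exists.mp (ne_top_of_lt h')
            simp only [Finset.mem_union, Finset.mem_filter, Finset.mem_univ, true_and,
              h0, h1', false_and, or_self, if_false]
            rw [← hn] at h0 h1' ⊢
            norm_cast at h0 h1' ⊢
            omega
    · ext q
      by_cases h0 : f q = 0 <;> simp [h0]

theorem factorialBound_tightRankings [Finite Q] {x y : ℝ} (hx : 0 < x) (hx1 : x ≤ 1)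
    (hy : y = Real.exp x) (k : ℕ) :
    FactorialBound x ((y * y * (y - 1)) ^ k) (tightRankings (Q := Q) k) := by
  have hy1 : 1 ≤ y := hy ▸ Real.one_le_exp hx.le
  have hz : 0 ≤ y * y * (y - 1) := by
    have : 0 ≤ y - 1 := by linarith
    positivity
  have b0 : ∀ n : ℕ, ∑ j ∈ Finset.Ico 0 (n + 1), x ^ j / j.factorial ≤ y := fun n => by
    rw [hy, ← Finset.range_eq_Ico]
    exact Real.sum_le_exp_of_nonneg hx.le _
  have b1 : ∀ n : ℕ, ∑ j ∈ Finset.Ico 1 (n + 1), x ^ j / j.factorial ≤ y - 1 := fun n => by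
    have := b0 n
    rw [Finset.sum_eq_sum_Ico_succ_bot (Nat.succ_pos n)] at this
    simp at this
    linarith
  induction k with
  | zero =>
    intro S
    refine ⟨(Set.finite_singleton _).subset (tightRankings_zero_subset S), ?_⟩
    have h1 : (tightRankings 0 S).ncard ≤ 1 := by
      rw [← Set.ncard_singleton ((fun _ => ⊤, ∅) : (Q → ℕ∞) × Finset Q)]
      exact Set.ncard_le_ncard (tightRankings_zero_subset S)
    -- The leftover vertices are all unranked in a single way; `x ≤ 1` lets this fit the bound.
    have h2 : (1 : ℝ) ≤ S.card.factorial / x ^ S.card := by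
      rw [le_div_iff₀ (by positivity), one_mul]
      refine (pow_le_one₀ hx.le hx1).trans ?_
      exact_mod_cast Nat.factorial_pos _
    calc ((tightRankings 0 S).ncard : ℝ) ≤ 1 := by exact_mod_cast h1
      _ ≤ _ := by simpa using h2
  | succ k ih =>
    have h := ((ih.peel hx (by positivity) b1).peel hx
      (mul_nonneg (by positivity) (by linarith)) b0).peel hx
      (mul_nonneg (mul_nonneg (by positivity) (by linarith)) (by linarith)) b0
    intro S
    obtain ⟨hf, hc⟩ := h S
    have hsub := tightRankings_succ_subset k S
    refine ⟨(hf.image _).subset hsub, ?_⟩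
    have h1 := (Set.ncard_le_ncard hsub (hf.image _)).trans (Set.ncard_image_le hf)
    calc _ ≤ (((_root_.peel 0 (_root_.peel 0 (_root_.peel 1 (tightRankings k))) S).ncard : ℕ) : ℝ) :=
          by exact_mod_cast h1
      _ ≤ _ := hc
      _ = _ := by ring

end Counting

/-- The margin is small: `1.456 * 1.456 * 0.456 < 1` is what makes the series over `k` converge. -/
theorem exp_three_eighths_lt : Real.exp (3 / 8) < 1.456 := by
  have h : Real.exp (3 / 8) ^ 8 = Real.exp 1 ^ 3 := by
    rw [← Real.exp_nat_mul, ← Real.exp_nat_mul]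
    norm_num
  have h1 : Real.exp 1 ^ 3 < 2.7182818286 ^ 3 :=
    pow_lt_pow_left₀ Real.exp_one_lt_d9 (Real.exp_pos _).le (by norm_num)
  by_contra hlt
  have h2 : (1.456 : ℝ) ^ 8 ≤ Real.exp (3 / 8) ^ 8 :=
    pow_le_pow_left₀ (by norm_num) (not_lt.mp hlt) 8
  rw [h] at h2
  norm_num at h1 h2
  linarith

/-- Successive quotients of `n! / ((3/8)^n * n^n)` tend to `(8/3) / e < 1`, so the terms are
summable and each is at most the sum. -/
theorem exists_factorial_div_pow_le :
    ∃ K : ℝ, 0 < K ∧ ∀ n : ℕ, 1 ≤ n → (n.factorial : ℝ) / (3 / 8) ^ n ≤ K * (n : ℝ) ^ n := by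
  have hlim : Tendsto (fun n : ℕ => (8 / 3 : ℝ) / (1 + 1 / (n : ℝ)) ^ n) atTop
      (nhds ((8 / 3) / Real.exp 1)) :=
    tendsto_const_nhds.div (Real.tendsto_one_add_div_pow_exp 1) (Real.exp_pos 1).ne'
  have hl1 : (8 / 3 : ℝ) / Real.exp 1 < 1 := by
    rw [div_lt_one (Real.exp_pos 1)]
    have := Real.exp_one_gt_d9
    linarith
  let a : ℕ → ℝ := fun n => n.factorial / (3 / 8) ^ n / (n : ℝ) ^ n
  have hpos : ∀ n, 0 < a n := fun n => by
    rcases Nat.eq_zero_or_pos n with rfl | hn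
    · simp [a]
    · have : (0 : ℝ) < n := by exact_mod_cast hn
      positivity
  have hratio : ∀ᶠ n : ℕ in atTop, (8 / 3 : ℝ) / (1 + 1 / (n : ℝ)) ^ n = ‖a (n + 1)‖ / ‖a n‖ := by
    filter_upwards [eventually_ge_atTop 1] with n hn
    have hn0 : (0 : ℝ) < n := by exact_mod_cast hn
    rw [Real.norm_of_nonneg (hpos _).le, Real.norm_of_nonneg (hpos _).le]
    have e : (1 + 1 / (n : ℝ)) ^ n = ((n : ℝ) + 1) ^ n / (n : ℝ) ^ n := by
      rw [← div_pow]; congr 1; field_simp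
    simp only [a, e]
    rw [Nat.factorial_succ]
    push_cast
    rw [pow_succ, pow_succ]
    field_simp
  have hsum : Summable a := summable_of_ratio_test_tendsto_lt_one hl1
    (Eventually.of_forall fun n => (hpos n).ne') (hlim.congr' hratio)
  refine ⟨∑' n, a n, hsum.tsum_pos (fun n => (hpos n).le) 0 (hpos 0), fun n hn => ?_⟩
  have hn0 : (0 : ℝ) < n := by exact_mod_cast hn
  rw [← div_le_iff₀ (by positivity)]
  exact hsum.le_tsum n fun j _ => (hpos j).le

/-- The number of tight rankings of `n` vertices with a distinguished set of vertices of even rank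
is `O(n ^ n)`. -/
theorem exists_ncard_tightRankings_le :
    ∃ K : ℝ, 0 < K ∧ ∀ (Q : Type v) [Finite Q] [Nonempty Q],
      {p : (Q → ℕ∞) × Finset Q | ∃ k, IsTightRanking k p}.Finite ∧
        ({p : (Q → ℕ∞) × Finset Q | ∃ k, IsTightRanking k p}.ncard : ℝ) ≤ K * (Nat.card Q : ℝ) ^ Nat.card Q := by
  obtain ⟨K, hK, hKn⟩ := exists_factorial_div_pow_le
  set y := Real.exp (3 / 8) with hy
  set g := y * y * (y - 1)
  have hy1 : 1 ≤ y := Real.one_le_exp (by norm_num)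
  have hy2 : y < 1.456 := exp_three_eighths_lt
  have hg0 : 0 ≤ g := mul_nonneg (by positivity) (by linarith)
  have hg1 : g < 1 := by
    have h1 : y * y ≤ 1.456 * 1.456 := mul_le_mul hy2.le hy2.le (by linarith) (by norm_num)
    calc g ≤ (1.456 * 1.456) * 0.456 :=
          mul_le_mul h1 (by linarith) (by linarith) (by norm_num)
      _ < 1 := by norm_num
  refine ⟨(1 - g)⁻¹ * K, mul_pos (inv_pos.mpr (by linarith)) hK, ?_⟩
  intro Q _ _
  classical
  have := Fintype.ofFinite Q
  set n := Nat.card Q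
  set S : Finset Q := Finset.univ with hS'
  have hS : S.card = n := by rw [hS', Finset.card_univ, ← Nat.card_eq_fintype_card]
  have hbd := fun k => factorialBound_tightRankings (Q := Q) (x := 3 / 8) (y := y)
    (by norm_num) (by norm_num) hy k S
  have hk : {p : (Q → ℕ∞) × Finset Q | ∃ k, IsTightRanking k p} = ⋃ k ∈ Finset.range (n + 1), tightRankings k S := by
    ext p
    simp only [Set.mem_iUnion, Finset.mem_range, exists_prop, Set.mem_ofPred_eq]
    refine ⟨fun ⟨k, h⟩ => ⟨k, ?_, fun q hq => absurd (Finset.mem_univ q) hq, h⟩,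
      fun ⟨k, _, h⟩ => ⟨k, h.2⟩⟩
    -- Distinct odd ranks are taken by distinct vertices, so `k ≤ n`.
    choose φ hφ using fun j : Fin k => h.2.1 j j.2
    have hinj : Function.Injective φ := fun i j hij => by
      have := (hφ i).symm.trans (hij ▸ hφ j)
      norm_cast at this
      apply Fin.ext
      omega
    have := Nat.card_le_card_of_injective φ hinj
    rw [Nat.card_fin] at this
    omega
  rw [hk]
  refine ⟨Set.Finite.biUnion (Finset.finite_toSet _) fun k _ => (hbd k).1, ?_⟩
  have h1 : ((⋃ k ∈ Finset.range (n + 1), tightRankings k S).ncard : ℝ) ≤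
      ∑ k ∈ Finset.range (n + 1), ((tightRankings k S).ncard : ℝ) := by
    exact_mod_cast Finset.set_ncard_biUnion_le _ _
  have h2 : ∑ k ∈ Finset.range (n + 1), g ^ k ≤ (1 - g)⁻¹ := by
    rw [← tsum_geometric_of_lt_one hg0 hg1]
    exact (summable_geometric_of_lt_one hg0 hg1).sum_le_tsum _ fun k _ => pow_nonneg hg0 k
  have hF : (0 : ℝ) ≤ n.factorial / (3 / 8) ^ n := by positivity
  calc _ ≤ _ := h1
    _ ≤ ∑ k ∈ Finset.range (n + 1), g ^ k * (n.factorial / (3 / 8) ^ n) :=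
        Finset.sum_le_sum fun k _ => by simpa only [hS] using (hbd k).2
    _ = (∑ k ∈ Finset.range (n + 1), g ^ k) * (n.factorial / (3 / 8) ^ n) := by
        rw [Finset.sum_mul]
    _ ≤ (1 - g)⁻¹ * (n.factorial / (3 / 8) ^ n) := mul_le_mul_of_nonneg_right h2 hF
    _ ≤ (1 - g)⁻¹ * (K * (n : ℝ) ^ n) :=
        mul_le_mul_of_nonneg_left (hKn n Nat.card_pos) (inv_nonneg.mpr (by linarith))
    _ = _ := by ring

/-! ### Rankings of run graphs -/

section RunGraph

variable {Q : Type v} (E acc : ℕ → Q → Q → Prop) (init : Q)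

/-- The vertices on each level of the run graph. -/
def reachable : ℕ → Set Q
  | 0 => {init}
  | i + 1 => {q' | ∃ q ∈ reachable i, E i q q'}

/-- The vertex `q` on level `i` starts a path of length `t` inside of `U`. -/
def HasPath (U : ℕ → Set Q) : ℕ → ℕ → Q → Prop
  | 0, i, q => q ∈ U i
  | t + 1, i, q => q ∈ U i ∧ ∃ q', E i q q' ∧ HasPath U t (i + 1) q'

/-- The vertices that start arbitrarily long paths inside of `U`. -/
def endless (U : ℕ → Set Q) (i : ℕ) : Set Q := {q | ∀ t, HasPath E U t i q}

/-- The vertex `q` on level `i` starts a path inside of `U` whose edge number `t` is accepting. -/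
def Hits (U : ℕ → Set Q) : ℕ → ℕ → Q → Prop
  | 0, i, q => q ∈ U i ∧ ∃ q', E i q q' ∧ acc i q q' ∧ q' ∈ U (i + 1)
  | t + 1, i, q => q ∈ U i ∧ ∃ q', E i q q' ∧ Hits U t (i + 1) q'

/-- The vertices that start a path inside of `U` with an accepting edge. -/
def hitting (U : ℕ → Set Q) (i : ℕ) : Set Q := {q | ∃ t, Hits E acc U t i q}

/-- The vertices that are left after alternately deleting those which do not start arbitrarily long
paths and those which do not lead to accepting edges. -/
def residue : ℕ → ℕ → Set Q
  | 0 => reachable E init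
  | r + 1 => if Even r then endless E (residue r) else hitting E acc (residue r)

/-- The set `U` contains the reachable predecessors of its elements. -/
def PredClosed (U : ℕ → Set Q) : Prop :=
  ∀ i q q', q ∈ reachable E init i → E i q q' → q' ∈ U (i + 1) → q ∈ U i

variable {E acc init} {U : ℕ → Set Q}

theorem HasPath.mem {t i : ℕ} {q : Q} (h : HasPath E U t i q) : q ∈ U i := by
  cases t with
  | zero => exact h
  | succ t => exact h.1

theorem Hits.mem {t i : ℕ} {q : Q} (h : Hits E acc U t i q) : q ∈ U i := by
  cases t with
  | zero => exact h.1
  | succ t => exact h.1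

theorem HasPath.of_succ {t i : ℕ} {q : Q} (h : HasPath E U (t + 1) i q) : HasPath E U t i q := by
  induction t generalizing i q with
  | zero => exact h.1
  | succ t ih =>
    obtain ⟨h1, q', h2, h3⟩ := h
    exact ⟨h1, q', h2, ih h3⟩

theorem HasPath.anti {s t i : ℕ} {q : Q} (hst : s ≤ t) (h : HasPath E U t i q) :
    HasPath E U s i q := by
  induction t, hst using Nat.le_induction with
  | base => exact h
  | succ t _ ih => exact ih h.of_succ

theorem endless_subset (i : ℕ) : endless E U i ⊆ U i := fun _ h => h 0

theorem hitting_subset (i : ℕ) : hitting E acc U i ⊆ U i := fun _ ⟨_, h⟩ => h.mem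

/-- König's argument: if every successor had bounded paths, finiteness of `Q` would give a common
bound, and hence one for `q`. -/
theorem exists_succ_mem_endless [Finite Q] {i : ℕ} {q : Q} (h : q ∈ endless E U i) :
    ∃ q', E i q q' ∧ q' ∈ endless E U (i + 1) := by
  by_contra hno
  push Not at hno
  have h1 : ∀ q', ∃ t, E i q q' → ¬ HasPath E U t (i + 1) q' := fun q' => by
    by_cases hq : E i q q'
    · have := hno q' hq
      simp only [endless, Set.mem_ofPred_eq, not_forall] at this
      obtain ⟨t, ht⟩ := this
      exact ⟨t, fun _ => ht⟩
    · exact ⟨0, fun h => absurd h hq⟩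
  choose t ht using h1
  obtain ⟨T, hT⟩ := (Set.finite_range t).bddAbove
  obtain ⟨-, q', hq', hp⟩ := h (T + 1)
  exact ht q' hq' (hp.anti (hT ⟨q', rfl⟩))

theorem residue_succ_subset (r i : ℕ) :
    residue E acc init (r + 1) i ⊆ residue E acc init r i := by
  rw [residue]
  split_ifs
  · exact endless_subset i
  · exact hitting_subset i

theorem residue_antitone (i : ℕ) : Antitone fun r => residue E acc init r i :=
  antitone_nat_of_succ_le fun r => residue_succ_subset r i

theorem residue_subset_reachable (r i : ℕ) : residue E acc init r i ⊆ reachable E init i :=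
  residue_antitone i (Nat.zero_le r)

theorem PredClosed.endless (h : PredClosed E init U) : PredClosed E init (endless E U) := by
  intro i q q' hq hE hq' t
  have hqU := h i q q' hq hE (hq' 0)
  cases t with
  | zero => exact hqU
  | succ t => exact ⟨hqU, q', hE, hq' t⟩

theorem PredClosed.hitting (h : PredClosed E init U) : PredClosed E init (hitting E acc U) := by
  rintro i q q' hq hE ⟨t, ht⟩
  exact ⟨t + 1, h i q q' hq hE ht.mem, q', hE, ht⟩

theorem predClosed_residue (r : ℕ) : PredClosed E init (residue E acc init r) := by
  induction r with
  | zero => exact fun i q q' hq _ _ => hq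
  | succ r ih =>
    rw [residue]
    split_ifs
    · exact ih.endless
    · exact ih.hitting

/-- A path from a reachable vertex extends backwards to the root without leaving a
predecessor-closed set, gaining one edge per level. -/
theorem PredClosed.hasPath_init (h : PredClosed E init U)
    (hU : ∀ i, U i ⊆ reachable E init i) {i s : ℕ} {q : Q} (hq : HasPath E U s i q) :
    HasPath E U (s + i) 0 init := by
  induction i generalizing s q with
  | zero =>
    have : q = init := hU 0 hq.mem
    exact this ▸ hq
  | succ i ih =>
    obtain ⟨p, hp, hE⟩ := hU (i + 1) hq.mem
    have := ih (s := s + 1) ⟨h i p q hp hE hq.mem, q, hE, hq⟩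
    rwa [Nat.add_right_comm] at this

theorem PredClosed.init_mem_endless (h : PredClosed E init U)
    (hU : ∀ i, U i ⊆ reachable E init i) {i : ℕ} {q : Q} (hq : q ∈ _root_.endless E U i) :
    init ∈ _root_.endless E U 0 :=
  fun t => (h.hasPath_init hU (hq t)).anti (Nat.le_add_right t i)

/-- If all vertices of `U` lead to accepting edges inside of `U`, then there is a path with
infinitely many accepting edges. -/
theorem exists_path_frequently_acc (hU : ∀ i, ∀ q ∈ U i, q ∈ hitting E acc U i)
    (h0 : init ∈ U 0) :
    ∃ ρ : ℕ → Q, ρ 0 = init ∧ (∀ i, E i (ρ i) (ρ (i + 1))) ∧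
      ∃ᶠ i in atTop, acc i (ρ i) (ρ (i + 1)) := by
  -- The second component counts down to the next accepting edge; at 0 that edge is taken and a new
  -- countdown starts.
  have step : ∀ i (p : Q × ℕ), ∃ p' : Q × ℕ, Hits E acc U p.2 i p.1 →
      Hits E acc U p'.2 (i + 1) p'.1 ∧ E i p.1 p'.1 ∧ (p.2 = 0 → acc i p.1 p'.1) ∧
        (p.2 ≠ 0 → p'.2 + 1 = p.2) := by
    rintro i ⟨q, t⟩
    by_cases hq : Hits E acc U t i q
    · cases t with
      | zero =>
        obtain ⟨_, q', hE, ha, hq'⟩ := hq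
        obtain ⟨t', ht'⟩ := hU _ _ hq'
        exact ⟨(q', t'), fun _ => ⟨ht', hE, fun _ => ha, fun h => absurd rfl h⟩⟩
      | succ t =>
        obtain ⟨_, q', hE, hq'⟩ := hq
        exact ⟨(q', t), fun _ => ⟨hq', hE, fun h => absurd h t.succ_ne_zero, fun _ => rfl⟩⟩
    · exact ⟨(q, t), fun h => absurd h hq⟩
  choose next hnext using step
  obtain ⟨t0, ht0⟩ := hU 0 init h0
  let P : ℕ → Q × ℕ := fun i => Nat.rec (init, t0) next i
  have hP : ∀ i, Hits E acc U (P i).2 i (P i).1 := fun i => by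
    induction i with
    | zero => exact ht0
    | succ i ih => exact (hnext i (P i) ih).1
  refine ⟨fun i => (P i).1, rfl, fun i => (hnext i (P i) (hP i)).2.1, ?_⟩
  rw [frequently_atTop]
  have key : ∀ t i, (P i).2 = t → ∃ j ≥ i, acc j (P j).1 (P (j + 1)).1 := by
    intro t
    induction t with
    | zero => exact fun i hi => ⟨i, le_rfl, (hnext i (P i) (hP i)).2.2.1 hi⟩
    | succ t ih =>
      intro i hi
      have h : (P (i + 1)).2 + 1 = (P i).2 := (hnext i (P i) (hP i)).2.2.2 (by omega)
      obtain ⟨j, hj, ha⟩ := ih (i + 1) (by omega)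
      exact ⟨j, by omega, ha⟩
  exact fun i => key _ i rfl

/-- The rank of a vertex: the stage at which it is deleted. -/
noncomputable def vertexRank (E acc : ℕ → Q → Q → Prop) (init : Q) (i : ℕ) (q : Q) : ℕ :=
  sInf {r | q ∉ residue E acc init (r + 1) i}

theorem vertexRank_le {i r : ℕ} {q : Q} (h : q ∉ residue E acc init (r + 1) i) :
    vertexRank E acc init i q ≤ r :=
  Nat.sInf_le h

theorem notMem_residue_vertexRank {i r : ℕ} {q : Q} (h : q ∉ residue E acc init (r + 1) i) :
    q ∉ residue E acc init (vertexRank E acc init i q + 1) i :=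
  Nat.sInf_mem (s := {r | q ∉ residue E acc init (r + 1) i}) ⟨r, h⟩

theorem mem_residue_vertexRank {i : ℕ} {q : Q} (h : q ∈ reachable E init i) :
    q ∈ residue E acc init (vertexRank E acc init i q) i := by
  cases hr : vertexRank E acc init i q with
  | zero => exact h
  | succ r =>
    by_contra hq
    have := vertexRank_le hq
    omega

theorem vertexRank_eq {i r : ℕ} {q : Q} (h : q ∈ residue E acc init r i)
    (h' : q ∉ residue E acc init (r + 1) i) : vertexRank E acc init i q = r := by
  refine le_antisymm (vertexRank_le h') ?_
  by_contra hlt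
  exact notMem_residue_vertexRank h' (residue_antitone i (by omega) h)

/-- If no vertex of the residue `2j+1` were deleted next, there would be a path with infinitely many
accepting edges. A deleted vertex has an endless successor, which is deleted too, since otherwise
its predecessor would reach an accepting edge. Hence rank `2j+1` occurs on every later level. -/
theorem exists_level_odd [Finite Q]
    (hacc : ∀ ρ : ℕ → Q, ρ 0 = init → (∀ i, E i (ρ i) (ρ (i + 1))) →
      ∀ᶠ i in atTop, ¬ acc i (ρ i) (ρ (i + 1))) {j i : ℕ} {q : Q}
    (hq : q ∈ residue E acc init (2 * j + 1) i) :
    ∃ l, ∀ i ≥ l, ∃ q, q ∈ residue E acc init (2 * j + 1) i ∧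
      q ∉ residue E acc init (2 * j + 1 + 1) i := by
  have e1 : residue E acc init (2 * j + 1) = endless E (residue E acc init (2 * j)) := by
    rw [residue, if_pos (even_two_mul j)]
  have e2 : residue E acc init (2 * j + 1 + 1) =
      hitting E acc (residue E acc init (2 * j + 1)) := by
    rw [residue, if_neg (by simp)]
  have h0 : init ∈ residue E acc init (2 * j + 1) 0 := by
    rw [e1] at hq ⊢
    exact (predClosed_residue _).init_mem_endless (residue_subset_reachable _) hq
  have hex : ∃ l q, q ∈ residue E acc init (2 * j + 1) l ∧
      q ∉ residue E acc init (2 * j + 1 + 1) l := by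
    by_contra hno
    push Not at hno
    rw [e2] at hno
    obtain ⟨ρ, h1, h2, h3⟩ := exists_path_frequently_acc hno h0
    exact h3 (hacc ρ h1 h2)
  obtain ⟨l, hl⟩ := hex
  refine ⟨l, fun i hi => ?_⟩
  induction i, hi using Nat.le_induction with
  | base => exact hl
  | succ i _ ih =>
    obtain ⟨q, hq, hq'⟩ := ih
    rw [e1] at hq
    obtain ⟨p, hE, hp⟩ := exists_succ_mem_endless hq
    rw [← e1] at hq hp
    refine ⟨p, hp, fun hp' => hq' ?_⟩
    rw [e2] at hp' ⊢
    obtain ⟨t, ht⟩ := hp'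
    exact ⟨t + 1, hq, p, hE, ht⟩

/-- From some level on, the ranking of the vertices is tight. -/
theorem exists_eventually_tight [Finite Q]
    (hacc : ∀ ρ : ℕ → Q, ρ 0 = init → (∀ i, E i (ρ i) (ρ (i + 1))) →
      ∀ᶠ i in atTop, ¬ acc i (ρ i) (ρ (i + 1))) :
    ∃ k N, ∀ i ≥ N, (∀ q, q ∉ residue E acc init (2 * k) i) ∧
      ∀ j < k, ∃ q ∈ reachable E init i, vertexRank E acc init i q = 2 * j + 1 := by
  classical
  have hodd : ∀ j, (∃ i q, q ∈ residue E acc init (2 * j + 1) i) →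
      ∃ l, ∀ i ≥ l, ∃ q ∈ reachable E init i, vertexRank E acc init i q = 2 * j + 1 := by
    rintro j ⟨i, q, hq⟩
    obtain ⟨l, hl⟩ := exists_level_odd hacc hq
    refine ⟨l, fun i hi => ?_⟩
    obtain ⟨q, h1, h2⟩ := hl i hi
    exact ⟨q, residue_subset_reachable _ _ h1, vertexRank_eq h1 h2⟩
  -- Otherwise a single level would carry `Nat.card Q + 1` distinct odd ranks.
  have hempty : ∃ k, ∀ i q, q ∉ residue E acc init (2 * k + 1) i := by
    by_contra hno
    push Not at hno
    choose l hl using fun j => hodd j (hno j)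
    obtain ⟨L, hL⟩ := (Set.finite_range fun j : Fin (Nat.card Q + 1) => l j).bddAbove
    choose φ hφ1 hφ2 using fun j : Fin (Nat.card Q + 1) => hl j L (hL ⟨j, rfl⟩)
    have hinj : Function.Injective φ := fun a b hab => by
      have h1 := hφ2 a
      rw [hab, hφ2 b] at h1
      apply Fin.ext
      omega
    have := Nat.card_le_card_of_injective φ hinj
    rw [Nat.card_fin] at this
    omega
  have hmin : ∀ j < Nat.find hempty, ∃ l, ∀ i ≥ l, ∃ q ∈ reachable E init i,
      vertexRank E acc init i q = 2 * j + 1 := fun j hj => by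
    have := Nat.find_min hempty hj
    push Not at this
    exact hodd j this
  set k := Nat.find hempty with hk
  have hk' := Nat.find_spec hempty
  rw [← hk] at hk'
  choose! l hl using hmin
  -- Paths from the root inside the residue `2k` have length below `t`, so this residue is empty
  -- from level `t` on.
  have hfin : ∃ t, ¬ HasPath E (residue E acc init (2 * k)) t 0 init := by
    have := hk' 0 init
    rw [residue, if_pos (even_two_mul k)] at this
    simpa [endless] using this
  obtain ⟨t, ht⟩ := hfin
  refine ⟨k, t + ∑ j ∈ Finset.range k, l j, fun i hi => ⟨fun q hq => ht ?_, fun j hj => ?_⟩⟩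
  · have h : HasPath E (residue E acc init (2 * k)) 0 i q := hq
    exact ((predClosed_residue _).hasPath_init (residue_subset_reachable _) h).anti (by omega)
  · refine hl j hj i ?_
    have := Finset.single_le_sum (f := l) (fun _ _ => Nat.zero_le _) (Finset.mem_range.mpr hj)
    omega

end RunGraph

/-! ### Soundness and completeness of tight rankings as certificates -/

section TightRuns

variable {Q : Type v}

/-- The conditions on successive rankings: ranks do not increase along edges, odd ranks decrease
along accepting edges, and the second component collects the successors of the same rank, starting
afresh from all vertices of even rank when it is empty. -/
def TightStep (E acc : Q → Q → Prop) (p p' : (Q → ℕ∞) × Finset Q) : Prop :=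
  (∀ q q', E q q' → p'.1 q' ≤ p.1 q ∧
    (acc q q' → ∀ j : ℕ, p.1 q = (2 * j + 1 : ℕ) → p'.1 q' < p.1 q) ∧
    (q ∈ p.2 → p'.1 q' = p.1 q → q' ∈ p'.2)) ∧
  (p.2 = ∅ → ∀ q (j : ℕ), p'.1 q = (2 * j : ℕ) → q ∈ p'.2)

variable {E acc : ℕ → Q → Q → Prop} {init : Q}

/-- The rank along the path is finite and eventually constant. Were it even, the path would enter
the second component right after it is empty and never leave, contradicting the next time it is
empty. So it is odd, and an accepting edge would lower it. -/
theorem eventually_not_acc_of_tightStep {N : ℕ} {p : ℕ → (Q → ℕ∞) × Finset Q}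
    (hp : ∀ i ≥ N, TightStep (E i) (acc i) (p i) (p (i + 1)))
    (hempty : ∃ᶠ i in atTop, (p i).2 = ∅) {ρ : ℕ → Q} (hρ : ∀ i, E i (ρ i) (ρ (i + 1)))
    (hN : (p N).1 (ρ N) ≠ ⊤) : ∀ᶠ i in atTop, ¬ acc i (ρ i) (ρ (i + 1)) := by
  set g : ℕ → ℕ∞ := fun i => (p i).1 (ρ i) with hg
  have hstep : ∀ i ≥ N, g (i + 1) ≤ g i := fun i hi => ((hp i hi).1 _ _ (hρ i)).1
  have hanti : ∀ i ≥ N, ∀ j ≥ i, g j ≤ g i := fun i hi j hj => by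
    induction j, hj using Nat.le_induction with
    | base => exact le_rfl
    | succ j hij ih => exact (hstep j (le_trans hi hij)).trans ih
  obtain ⟨c, ⟨M, hM, hMc⟩, hmin⟩ := wellFounded_lt.has_min (g '' Set.Ici N)
    ⟨_, N, Set.mem_Ici.mpr le_rfl, rfl⟩
  replace hM : N ≤ M := Set.mem_Ici.mp hM
  have hconst : ∀ i ≥ M, g i = c := fun i hi =>
    le_antisymm (hMc ▸ hanti M hM i hi) (not_lt.mp (hmin _ ⟨i, Set.mem_Ici.mpr (le_trans hM hi), rfl⟩))
  have hc : c ≠ ⊤ := fun h => hN (top_le_iff.mp (h ▸ hMc ▸ hanti N le_rfl M hM))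
  obtain ⟨n, rfl⟩ := ENat.ne_top_iff_exists.mp hc
  obtain ⟨j, rfl | rfl⟩ := Nat.even_or_odd' n
  · exfalso
    obtain ⟨i, hi, hie⟩ := frequently_atTop.mp hempty M
    have hmem : ∀ l ≥ i + 1, ρ l ∈ (p l).2 := fun l hl => by
      induction l, hl using Nat.le_induction with
      | base => exact (hp i (by omega)).2 hie _ j (hconst _ (by omega))
      | succ l hl ih =>
        exact ((hp l (by omega)).1 _ _ (hρ l)).2.2 ih
          ((hconst (l + 1) (by omega)).trans (hconst l (by omega)).symm)
    obtain ⟨l, hl, hle⟩ := frequently_atTop.mp hempty (i + 1)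
    have := hmem l hl
    rw [hle] at this
    exact absurd this (Finset.notMem_empty _)
  · filter_upwards [eventually_ge_atTop M] with i hi ha
    have := ((hp i (by omega)).1 _ _ (hρ i)).2.1 ha j (hconst i hi)
    exact absurd ((hconst (i + 1) (by omega)).trans (hconst i hi).symm) this.ne

variable (E acc init) in
open Classical in
/-- The ranking of a level of the run graph by `vertexRank`. -/
noncomputable def levelRank (i : ℕ) (q : Q) : ℕ∞ :=
  if q ∈ reachable E init i then (vertexRank E acc init i q : ℕ∞) else ⊤

theorem levelRank_eq_natCast {i n : ℕ} {q : Q} :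
    levelRank E acc init i q = n ↔ q ∈ reachable E init i ∧ vertexRank E acc init i q = n := by
  unfold levelRank
  split_ifs with h
  · simp [h]
  · simp [h]

variable (E acc init) in
open Classical in
/-- The vertices of even rank on a level that are still to be left by all paths of constant
rank. -/
noncomputable def pending [Fintype Q] : ℕ → Finset Q
  | 0 => ∅
  | i + 1 => if pending i = ∅ then
      Finset.univ.filter fun q => ∃ j : ℕ, levelRank E acc init (i + 1) q = (2 * j : ℕ)
    else Finset.univ.filter fun q' => ∃ q ∈ pending i, E i q q' ∧
      levelRank E acc init (i + 1) q' = levelRank E acc init i q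

theorem even_of_mem_pending [Fintype Q] {i : ℕ} {q : Q} (h : q ∈ pending E acc init i) :
    ∃ j : ℕ, levelRank E acc init i q = (2 * j : ℕ) := by
  classical
  induction i generalizing q with
  | zero => exact absurd h (Finset.notMem_empty q)
  | succ i ih =>
    rw [pending] at h
    split_ifs at h
    · exact (Finset.mem_filter.mp h).2
    · obtain ⟨-, p, hp, -, he⟩ := Finset.mem_filter.mp h
      rw [he]
      exact ih hp

/-- Without a reset, a pending vertex has a pending predecessor of the same rank. Going back `t`
levels gives long paths inside the residue `2j`, which a vertex of rank `2j` cannot start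
indefinitely. -/
theorem exists_hasPath_of_mem_pending [Fintype Q] {i j : ℕ} (t s : ℕ) (q : Q)
    (hne : ∀ l ≥ i, pending E acc init l ≠ ∅) (hq : q ∈ pending E acc init (i + t))
    (hj : levelRank E acc init (i + t) q = (2 * j : ℕ))
    (hs : HasPath E (residue E acc init (2 * j)) s (i + t) q) :
    ∃ q₀, levelRank E acc init i q₀ = (2 * j : ℕ) ∧
      HasPath E (residue E acc init (2 * j)) (s + t) i q₀ := by
  classical
  induction t generalizing s q with
  | zero => exact ⟨q, hj, hs⟩
  | succ t ih =>
    rw [← add_assoc, pending, if_neg (hne _ (Nat.le_add_right i t))] at hq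
    obtain ⟨-, p, hp, hE, he⟩ := Finset.mem_filter.mp hq
    have hpj : levelRank E acc init (i + t) p = (2 * j : ℕ) := he.symm.trans hj
    obtain ⟨hp1, hp2⟩ := levelRank_eq_natCast.mp hpj
    have hmem := mem_residue_vertexRank (acc := acc) hp1
    rw [hp2] at hmem
    have := ih (s + 1) p hp hpj ⟨hmem, q, hE, hs⟩
    rwa [Nat.add_right_comm] at this

theorem exists_tightStep [Finite Q]
    (hacc : ∀ ρ : ℕ → Q, ρ 0 = init → (∀ i, E i (ρ i) (ρ (i + 1))) →
      ∀ᶠ i in atTop, ¬ acc i (ρ i) (ρ (i + 1))) :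
    ∃ (N : ℕ) (p : ℕ → (Q → ℕ∞) × Finset Q), (∀ i ≥ N, ∃ k, IsTightRanking k (p i)) ∧
      (∀ i, ∀ q ∈ reachable E init i, (p i).1 q ≠ ⊤) ∧
      (∀ i ≥ N, TightStep (E i) (acc i) (p i) (p (i + 1))) ∧ ∃ᶠ i in atTop, (p i).2 = ∅ := by
  classical
  have := Fintype.ofFinite Q
  obtain ⟨k, N, hN⟩ := exists_eventually_tight hacc
  have hodd : ∀ i ≥ N, ∀ q, q ∉ residue E acc init (2 * k + 1) i := fun i hi q h =>
    (hN i hi).1 q (residue_succ_subset _ _ h)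
  have hle : ∀ i ≥ N, ∀ q q', E i q q' →
      levelRank E acc init (i + 1) q' ≤ levelRank E acc init i q := by
    intro i hi q q' hE
    by_cases hq : q ∈ reachable E init i
    · have hq' : q' ∈ reachable E init (i + 1) := ⟨q, hq, hE⟩
      rw [levelRank, levelRank, if_pos hq, if_pos hq', Nat.cast_le]
      exact vertexRank_le fun h =>
        notMem_residue_vertexRank (hodd i hi q) (predClosed_residue _ i q q' hq hE h)
    · rw [levelRank, levelRank, if_neg hq]
      exact le_top
  refine ⟨N, fun i => (levelRank E acc init i, pending E acc init i), fun i hi => ⟨k, ?_, ?_, ?_⟩,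
    fun i q hq => ?_, fun i hi => ⟨fun q q' hE => ⟨hle i hi q q' hE, ?_, ?_⟩, ?_⟩, ?_⟩
  · intro q
    by_cases hq : q ∈ reachable E init i
    · right
      have h2k := (hN i hi).1 q
      obtain ⟨r, hr⟩ : ∃ r, 2 * k = r + 1 := by
        refine Nat.exists_eq_add_one_of_ne_zero fun h0 => h2k ?_
        rw [h0]
        exact hq
      simp only [levelRank, if_pos hq, Nat.cast_lt]
      have := vertexRank_le (hr ▸ h2k)
      omega
    · exact Or.inl (if_neg hq)
  · intro j hj
    obtain ⟨q, hq, hr⟩ := (hN i hi).2 j hj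
    exact ⟨q, levelRank_eq_natCast.mpr ⟨hq, hr⟩⟩
  · exact fun q hq => even_of_mem_pending hq
  · simp [levelRank, hq]
  · intro ha j hj
    obtain ⟨hq, hr⟩ := levelRank_eq_natCast.mp hj
    refine lt_of_le_of_ne (hle i hi q q' hE) fun heq => ?_
    obtain ⟨hq', hr'⟩ := levelRank_eq_natCast.mp (heq.trans hj)
    have h1 := mem_residue_vertexRank (acc := acc) hq
    have h2 := mem_residue_vertexRank (acc := acc) hq'
    have h3 := notMem_residue_vertexRank (hodd i hi q)
    rw [hr] at h1 h3
    rw [hr'] at h2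
    -- An accepting edge inside the residue `2j+1` would let `q` survive stage `2j+1`.
    apply h3
    rw [residue, if_neg (by simp)]
    exact ⟨0, h1, q', hE, ha, h2⟩
  · intro hq he
    have hne : pending E acc init i ≠ ∅ := Finset.ne_empty_of_mem hq
    simp only [pending, if_neg hne]
    exact Finset.mem_filter.mpr ⟨Finset.mem_univ _, q, hq, hE, he⟩
  · intro he q j hj
    simp only at he
    simp only [pending, if_pos he]
    exact Finset.mem_filter.mpr ⟨Finset.mem_univ _, j, hj⟩
  · rw [frequently_atTop]
    intro a
    by_contra! hne
    set b := max a N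
    have hne' : ∀ l ≥ b, pending E acc init l ≠ ∅ := fun l hl => by
      simpa [Finset.nonempty_iff_ne_empty] using hne l (le_trans (le_max_left a N) hl)
    -- Even-ranked vertices are deleted for having only bounded paths; by finiteness one bound `T`
    -- serves the whole level `b`, and a pending vertex at level `b + T` violates it.
    have hfin : ∀ q, ∃ t, ∀ j : ℕ, levelRank E acc init b q = (2 * j : ℕ) →
        ¬ HasPath E (residue E acc init (2 * j)) t b q := by
      intro q
      by_cases hq : ∃ j : ℕ, levelRank E acc init b q = (2 * j : ℕ)
      · obtain ⟨j, hj⟩ := hq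
        have h1 := notMem_residue_vertexRank (hodd b (le_max_right a N) q)
        rw [(levelRank_eq_natCast.mp hj).2, residue, if_pos (even_two_mul j)] at h1
        simp only [endless, Set.mem_ofPred_eq, not_forall] at h1
        obtain ⟨t, ht⟩ := h1
        refine ⟨t, fun j' hj' => ?_⟩
        have : j' = j := by
          have := hj'.symm.trans hj
          norm_cast at this
          omega
        rwa [this]
      · exact ⟨0, fun j hj => absurd ⟨j, hj⟩ hq⟩
    choose t ht using hfin
    obtain ⟨T, hT⟩ := (Set.finite_range t).bddAbove
    obtain ⟨q, hq⟩ := Finset.nonempty_iff_ne_empty.mpr (hne' (b + T) (Nat.le_add_right b T))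
    obtain ⟨j, hj⟩ := even_of_mem_pending hq
    obtain ⟨hq1, hq2⟩ := levelRank_eq_natCast.mp hj
    have hmem := mem_residue_vertexRank (acc := acc) hq1
    rw [hq2] at hmem
    obtain ⟨q₀, h1, h2⟩ := exists_hasPath_of_mem_pending (i := b) T 0 q hne' hq hj hmem
    exact ht q₀ j h1 (h2.anti (by have := hT ⟨q₀, rfl⟩; omega))

end TightRuns

/-! ### Limit superior of rational sequences with finite range -/

section LimSupValue

variable {x : ℕ → ℚ}

theorem isBoundedUnder_le_of_finite_range (hx : (Set.range x).Finite) :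
    IsBoundedUnder (· ≤ ·) atTop fun i => (x i : ℝ) := by
  obtain ⟨b, hb⟩ := hx.bddAbove
  exact isBoundedUnder_of ⟨b, fun i => Rat.cast_le.mpr (hb ⟨i, rfl⟩)⟩

theorem isCoboundedUnder_le_of_finite_range (hx : (Set.range x).Finite) :
    IsCoboundedUnder (· ≤ ·) atTop fun i => (x i : ℝ) := by
  obtain ⟨c, hc⟩ := hx.bddBelow
  exact isCoboundedUnder_le_of_le atTop (x := (c : ℝ)) fun i => Rat.cast_le.mpr (hc ⟨i, rfl⟩)

theorem limSupValue_le (hx : (Set.range x).Finite) {c : ℚ}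
    (h : ∀ᶠ i in atTop, x i ≤ c) : limSupValue x ≤ c :=
  limsup_le_of_le (isCoboundedUnder_le_of_finite_range hx)
    (h.mono fun _ hi => Rat.cast_le.mpr hi)

theorem le_limSupValue (hx : (Set.range x).Finite) {c : ℚ}
    (h : ∃ᶠ i in atTop, c ≤ x i) : (c : ℝ) ≤ limSupValue x :=
  le_limsup_of_frequently_le (h.mono fun _ hi => Rat.cast_le.mpr hi)
    (isBoundedUnder_le_of_finite_range hx)

theorem eventually_lt_of_limSupValue_lt (hx : (Set.range x).Finite) {c : ℚ}
    (h : limSupValue x < c) :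
    ∀ᶠ i in atTop, x i < c :=
  (eventually_lt_of_limsup_lt h (isBoundedUnder_le_of_finite_range hx)).mono
    fun _ hi => Rat.cast_lt.mp hi

end LimSupValue

/-! ### The complement automaton, its correctness and its size -/

namespace WeightedAutomaton

variable {α : Type u} (A : WeightedAutomaton.{u, v} α)

theorem finite_δ [Finite α] : Finite A.δ := by
  have := A.finite_state
  infer_instance

theorem finite_range_runWeights [Finite α] {w : ℕ → α} {r : ℕ → A.State} (h : A.IsRun w r) :
    (Set.range (A.runWeights h)).Finite := by
  have := A.finite_δ
  refine (Set.finite_range A.γ).subset ?_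
  rintro _ ⟨i, rfl⟩
  exact ⟨_, rfl⟩

/-- The states of the complement automaton: a sink, a phase that tracks the reachable states, and a
phase that tracks tight rankings, for a fixed bound on the weights that occur infinitely often. -/
abbrev ComplState : Type v :=
  Option (Set A.State ⊕ Set.range A.γ ×
    ({p | ∃ k, IsTightRanking k p} : Set ((A.State → ℕ∞) × Finset A.State)))

/-- The transition of `A` from `q` to `q'` exists and has a weight above `v`. -/
def Exceeds (v : ℚ) (a : α) (q q' : A.State) : Prop :=
  ∃ h : (q, a, q') ∈ A.δ, v < A.γ ⟨(q, a, q'), h⟩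

/-- The transitions of the complement automaton. -/
def ComplStep : A.ComplState → α → A.ComplState → Prop
  | _, _, none => True
  | some (.inl S), a, some (.inl S') => ∀ q ∈ S, ∀ q', (q, a, q') ∈ A.δ → q' ∈ S'
  | some (.inl S), a, some (.inr (_, p)) => ∀ q ∈ S, ∀ q', (q, a, q') ∈ A.δ → p.1.1 q' ≠ ⊤
  | some (.inr (v, p)), a, some (.inr (v', p')) =>
    v = v' ∧ TightStep (fun q q' => (q, a, q') ∈ A.δ) (A.Exceeds v a) p.1 p'.1
  | _, _, _ => False

open Classical in
/-- The weights of the complement automaton. -/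
noncomputable def complWeight (top : ℚ) : A.ComplState → A.ComplState → ℚ
  | some (.inr (v, p)), some (.inr _) => if p.1.2 = ∅ then 1 - v else 1 - top
  | _, _ => 1 - top

theorem finite_complState [Finite α] : Finite A.ComplState := by
  have := A.finite_state
  have := A.finite_δ
  have : Nonempty A.State := ⟨A.init⟩
  obtain ⟨_, -, h⟩ := exists_ncard_tightRankings_le.{v}
  have := (h A.State).1.to_subtype
  infer_instance

/-- The complement automaton. -/
noncomputable def compl [Finite α] (top : ℚ) : WeightedAutomaton.{u, v} α where
  State := A.ComplState
  finite_state := A.finite_complState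
  init := some (.inl {A.init})
  δ := {t | A.ComplStep t.1 t.2.1 t.2.2}
  total := fun q _ => ⟨none, by cases q <;> trivial⟩
  γ := fun t => A.complWeight top t.1.1 t.1.2.2

theorem language_le [Finite α] {w : ℕ → α} {c : ℝ}
    (h : ∀ (r : ℕ → A.State) (hr : A.IsRun w r), limSupValue (A.runWeights hr) ≤ c) :
    A.language limSupValue w ≤ c := by
  refine (A.isLUB_language_limSup w).2 ?_
  rintro _ ⟨r, hr, rfl⟩
  exact h r hr

theorem limSupValue_le_language [Finite α] {w : ℕ → α} {r : ℕ → A.State} (hr : A.IsRun w r) :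
    limSupValue (A.runWeights hr) ≤ A.language limSupValue w :=
  (A.isLUB_language_limSup w).1 ⟨r, hr, rfl⟩

variable {A} {top : ℚ}

theorem exists_inr_of_complWeight_ne {s s' : A.ComplState} (h : A.complWeight top s s' ≠ 1 - top) :
    ∃ v p y, s = some (.inr (v, p)) ∧ s' = some (.inr y) ∧ p.1.2 = ∅ := by
  rcases s with _ | S | ⟨v, p⟩
  · exact absurd rfl h
  · exact absurd rfl h
  · rcases s' with _ | S' | y
    · exact absurd rfl h
    · exact absurd rfl h
    · refine ⟨v, p, y, rfl, rfl, ?_⟩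
      by_contra hp
      exact h (if_neg hp)

variable [Finite α]

/-- The complement automaton does not overestimate the complement. -/
theorem language_compl_le (htop : ∀ t, A.γ t ≤ top) (w : ℕ → α) :
    (A.compl top).language limSupValue w ≤ 1 - A.language limSupValue w := by
  refine language_le _ fun (r : ℕ → A.ComplState) hr => ?_
  have hL : A.language limSupValue w ≤ top := A.language_le fun ρ hρ =>
    limSupValue_le (A.finite_range_runWeights hρ) (Eventually.of_forall fun i => htop _)
  have hfin := (A.compl top).finite_range_runWeights hr
  -- A run that eventually earns only `1 - top` is harmless because `L_A(w) ≤ top`. Any other run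
  -- avoids the sink, keeps a fixed `v`, and sees an empty second component infinitely often.
  by_cases hfreq : ∃ᶠ i in atTop, (A.compl top).runWeights hr i ≠ 1 - top
  swap
  · have h := limSupValue_le hfin (c := 1 - top)
      ((not_frequently.mp hfreq).mono fun i hi => (not_not.mp hi).le)
    push_cast at h
    linarith
  have hstep : ∀ i, A.ComplStep (r i) (w i) (r (i + 1)) := hr.2
  have htight : ∃ᶠ i in atTop, ∃ v p, r i = some (.inr (v, p)) ∧ p.1.2 = ∅ :=
    hfreq.mono fun i hi => by
      obtain ⟨v, p, y, h1, -, h2⟩ := exists_inr_of_complWeight_ne hi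
      exact ⟨v, p, h1, h2⟩
  obtain ⟨i₀, v, p₀, hi₀, -⟩ := htight.exists
  have hnone : ∀ i, r i ≠ none := by
    intro i hi
    have hall : ∀ j ≥ i, r j = none := fun j hj => by
      induction j, hj using Nat.le_induction with
      | base => exact hi
      | succ j _ ih =>
        have := hstep j
        rw [ih] at this
        rcases hj' : r (j + 1) with _ | S | y
        · rfl
        · rw [hj'] at this
          exact this.elim
        · rw [hj'] at this
          exact this.elim
    obtain ⟨j, hj, v, p, h, -⟩ := frequently_atTop.mp htight i
    exact Option.some_ne_none _ (h.symm.trans (hall j hj))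
  have hphase : ∀ i ≥ i₀, ∃ p, r i = some (.inr (v, p)) := fun i hi => by
    induction i, hi using Nat.le_induction with
    | base => exact ⟨p₀, hi₀⟩
    | succ i _ ih =>
      obtain ⟨p, hp⟩ := ih
      have := hstep i
      rw [hp] at this
      rcases hi' : r (i + 1) with _ | S | ⟨v', p'⟩
      · exact absurd hi' (hnone _)
      · rw [hi'] at this
        exact this.elim
      · rw [hi'] at this
        exact ⟨p', by rw [this.1]⟩
  have : Nonempty ({p | ∃ k, IsTightRanking k p} : Set ((A.State → ℕ∞) × Finset A.State)) := ⟨p₀⟩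
  choose! p hp using hphase
  have hts : ∀ i ≥ i₀, TightStep (fun q q' => (q, w i, q') ∈ A.δ) (A.Exceeds v (w i))
      (p i).1 (p (i + 1)).1 := fun i hi => by
    have := hstep i
    rw [hp i hi, hp (i + 1) (by omega)] at this
    exact this.2
  have hempty : ∃ᶠ i in atTop, (p i).1.2 = ∅ := by
    refine (htight.and_eventually (eventually_ge_atTop i₀)).mono ?_
    rintro i ⟨⟨v', p', h1, h2⟩, hi⟩
    have h := h1.symm.trans (hp i hi)
    simp only [Option.some.injEq, Sum.inr.injEq, Prod.mk.injEq] at h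
    rwa [← h.2]
  have hLv : A.language limSupValue w ≤ (v : ℚ) := A.language_le fun ρ hρ => by
    -- No run of `A` escapes the bookkeeping, so the soundness of rankings applies to every `ρ`.
    have htrack : ∀ i, (∃ S, r i = some (.inl S) ∧ ρ i ∈ S) ∨
        ∃ v p, r i = some (.inr (v, p)) ∧ p.1.1 (ρ i) ≠ ⊤ := by
      intro i
      induction i with
      | zero => exact Or.inl ⟨_, hr.1, hρ.1⟩
      | succ i ih =>
        have hs := hstep i
        rcases ih with ⟨S, hS, hm⟩ | ⟨v', p', hp', hm⟩
        · rw [hS] at hs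
          rcases hi' : r (i + 1) with _ | S' | ⟨v', p'⟩
          · exact absurd hi' (hnone _)
          · rw [hi'] at hs
            exact Or.inl ⟨S', rfl, hs _ hm _ (hρ.2 i)⟩
          · rw [hi'] at hs
            exact Or.inr ⟨v', p', rfl, hs _ hm _ (hρ.2 i)⟩
        · rw [hp'] at hs
          rcases hi' : r (i + 1) with _ | S' | ⟨v'', p''⟩
          · exact absurd hi' (hnone _)
          · rw [hi'] at hs
            exact hs.elim
          · rw [hi'] at hs
            exact Or.inr ⟨v'', p'', rfl, ne_top_of_le_ne_top hm (hs.2.1 _ _ (hρ.2 i)).1⟩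
    have hN : (p i₀).1.1 (ρ i₀) ≠ ⊤ := by
      rcases htrack i₀ with ⟨S, hS, -⟩ | ⟨v', p', hp', hm⟩
      · exact absurd (hS.symm.trans hi₀) (by simp)
      · have h := hp'.symm.trans (hp i₀ le_rfl)
        simp only [Option.some.injEq, Sum.inr.injEq, Prod.mk.injEq] at h
        rwa [← h.2]
    refine limSupValue_le (A.finite_range_runWeights hρ) ?_
    filter_upwards [eventually_not_acc_of_tightStep (p := fun i => (p i).1) hts hempty hρ.2 hN]
      with i hi
    exact not_lt.mp fun h => hi ⟨hρ.2 i, h⟩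
  have hv : (v : ℚ) ≤ top := by
    obtain ⟨t, ht⟩ := v.2
    exact ht ▸ htop t
  have h := limSupValue_le hfin (c := 1 - (v : ℚ)) <| by
    filter_upwards [eventually_ge_atTop i₀] with i hi
    change A.complWeight top (r i) (r (i + 1)) ≤ _
    rw [hp i hi, hp (i + 1) (by omega), complWeight]
    split_ifs
    · exact le_rfl
    · linarith
  push_cast at h
  linarith

/-- The value of a word is at least the least weight `v` such that no run has infinitely many
weights above `v`. -/
theorem exists_le_language (htop : ∀ t, A.γ t ≤ top) (htop' : top ∈ Set.range A.γ) (w : ℕ → α) :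
    ∃ v ∈ Set.range A.γ, (v : ℝ) ≤ A.language limSupValue w ∧
      ∀ (ρ : ℕ → A.State) (hρ : A.IsRun w ρ), ∀ᶠ i in atTop, A.runWeights hρ i ≤ v := by
  have := A.finite_δ
  let P : Set ℚ := {v | v ∈ Set.range A.γ ∧
    ∀ (ρ : ℕ → A.State) (hρ : A.IsRun w ρ), ∀ᶠ i in atTop, A.runWeights hρ i ≤ v}
  have hPf : P.Finite := (Set.finite_range A.γ).subset fun v h => h.1
  obtain ⟨v, hv, hmin⟩ := hPf.exists_minimal
    ⟨top, htop', fun ρ hρ => Eventually.of_forall fun i => htop _⟩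
  refine ⟨v, hv.1, ?_, hv.2⟩
  by_contra! hlt
  have hev : ∀ (ρ : ℕ → A.State) (hρ : A.IsRun w ρ), ∀ᶠ i in atTop, A.runWeights hρ i < v :=
    fun ρ hρ => eventually_lt_of_limSupValue_lt (A.finite_range_runWeights hρ)
      ((A.limSupValue_le_language hρ).trans_lt hlt)
  -- If all runs are eventually strictly below `v`, the next smaller weight `u` is also an eventual
  -- bound, contradicting minimality.
  have hBf : {u | u ∈ Set.range A.γ ∧ u < v}.Finite :=
    (Set.finite_range A.γ).subset fun v h => h.1
  have hBne : {u | u ∈ Set.range A.γ ∧ u < v}.Nonempty := by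
    obtain ⟨ρ, hρ⟩ := A.exists_isRun w
    obtain ⟨i, hi⟩ := (hev ρ hρ).exists
    exact ⟨_, ⟨_, rfl⟩, hi⟩
  obtain ⟨u, hu, humax⟩ := Set.exists_max_image _ id hBf hBne
  have huP : u ∈ P := ⟨hu.1, fun ρ hρ => (hev ρ hρ).mono fun i hi => humax _ ⟨⟨_, rfl⟩, hi⟩⟩
  exact absurd (hmin huP hu.2.le) (not_le.mpr hu.2)

/-- The complement automaton does not underestimate the complement. -/
theorem le_language_compl (htop : ∀ t, A.γ t ≤ top) (htop' : top ∈ Set.range A.γ) (w : ℕ → α) :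
    1 - A.language limSupValue w ≤ (A.compl top).language limSupValue w := by
  have := A.finite_state
  obtain ⟨v, hv, hvL, hvrun⟩ := exists_le_language htop htop' w
  obtain ⟨N, p, hp1, hp2, hp3, hp4⟩ := exists_tightStep
    (E := fun i q q' => (q, w i, q') ∈ A.δ) (acc := fun i => A.Exceeds v (w i)) (init := A.init)
    fun ρ h0 hE => (hvrun ρ ⟨h0, hE⟩).mono fun i hi ⟨_, hlt⟩ => not_lt.mpr hi hlt
  let r : ℕ → A.ComplState := fun i =>
    if h : N < i then some (.inr (⟨v, hv⟩, ⟨p i, hp1 i h.le⟩))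
    else some (.inl (reachable (fun i q q' => (q, w i, q') ∈ A.δ) A.init i))
  have hr1 : ∀ i (h : N < i), r i = some (.inr (⟨v, hv⟩, ⟨p i, hp1 i h.le⟩)) :=
    fun i h => dif_pos h
  have hr2 : ∀ i, ¬ N < i →
      r i = some (.inl (reachable (fun i q q' => (q, w i, q') ∈ A.δ) A.init i)) :=
    fun i h => dif_neg h
  have hr : (A.compl top).IsRun w r := by
    refine ⟨hr2 0 (Nat.not_lt_zero N), fun i => ?_⟩
    change A.ComplStep (r i) (w i) (r (i + 1))
    rcases lt_trichotomy N i with h | rfl | h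
    · rw [hr1 i h, hr1 (i + 1) (by omega)]
      exact ⟨rfl, hp3 i h.le⟩
    · rw [hr2 N (lt_irrefl N), hr1 (N + 1) (by omega)]
      exact fun q hq q' hE => hp2 (N + 1) q' ⟨q, hq, hE⟩
    · rw [hr2 i (by omega), hr2 (i + 1) (by omega)]
      exact fun q hq q' hE => ⟨q, hq, hE⟩
  have hle := le_limSupValue ((A.compl top).finite_range_runWeights hr) (c := 1 - v) <| by
    refine (hp4.and_eventually (eventually_gt_atTop N)).mono ?_
    rintro i ⟨he, hi⟩
    change _ ≤ A.complWeight top (r i) (r (i + 1))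
    rw [hr1 i hi, hr1 (i + 1) (by omega), complWeight, if_pos he]
  have := (A.compl top).limSupValue_le_language hr
  push_cast at hle
  linarith

variable (A) in
theorem numStates_compl_le {K : ℝ}
    (hK : (({p | ∃ k, IsTightRanking k p} : Set ((A.State → ℕ∞) × Finset A.State)).ncard : ℝ) ≤
      K * (A.numStates : ℝ) ^ A.numStates) [Nonempty α] :
    ((A.compl top).numStates : ℝ) ≤
      (K + 3) * (A.numTransitions * (A.numStates : ℝ) ^ A.numStates) := by
  have := A.finite_state
  have := A.finite_δ
  have hstate : Nonempty A.State := ⟨A.init⟩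
  have hδ : Nonempty A.δ := by
    obtain ⟨a⟩ := ‹Nonempty α›
    obtain ⟨q, hq⟩ := A.total A.init a
    exact ⟨_, hq⟩
  have hn : 1 ≤ A.numStates := Nat.card_pos
  have hm : 1 ≤ A.numTransitions := Nat.card_pos
  have : Finite ({p | ∃ k, IsTightRanking k p} : Set ((A.State → ℕ∞) × Finset A.State)) := by
    obtain ⟨_, -, h⟩ := exists_ncard_tightRankings_le.{v}
    exact (h A.State).1.to_subtype
  set T := ({p | ∃ k, IsTightRanking k p} : Set ((A.State → ℕ∞) × Finset A.State)).ncard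
  have hT : Nat.card ({p | ∃ k, IsTightRanking k p} :
      Set ((A.State → ℕ∞) × Finset A.State)) = T := Nat.card_coe_set_eq _
  -- The subsets account for 2 of the constant `K + 3`, the sink for 1, and the tight phase for `K`.
  have hcard : (A.compl top).numStates = 2 ^ A.numStates + Nat.card (Set.range A.γ) * T + 1 := by
    change Nat.card A.ComplState = _
    rw [Finite.card_option, Nat.card_sum, Nat.card_prod, hT]
    congr 2
    have := Fintype.ofFinite A.State
    rw [numStates, Nat.card_eq_fintype_card, Nat.card_eq_fintype_card, Fintype.card_set]
  have hW : Nat.card (Set.range A.γ) ≤ A.numTransitions := Finite.card_range_le A.γ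
  have h2 : (2 : ℝ) ^ A.numStates ≤ 2 * (A.numStates : ℝ) ^ A.numStates := by
    rcases hn.eq_or_lt with h | h
    · rw [← h]; norm_num
    · have h2n : (2 : ℝ) ≤ A.numStates := by exact_mod_cast h
      have := pow_le_pow_left₀ (by norm_num) h2n A.numStates
      have : (0 : ℝ) ≤ 2 ^ A.numStates := by positivity
      linarith
  have h1 : (1 : ℝ) ≤ (A.numStates : ℝ) ^ A.numStates :=
    one_le_pow₀ (by exact_mod_cast hn)
  have hm' : (1 : ℝ) ≤ A.numTransitions := by exact_mod_cast hm
  have hWT : (Nat.card (Set.range A.γ) : ℝ) * T ≤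
      A.numTransitions * (K * (A.numStates : ℝ) ^ A.numStates) :=
    mul_le_mul (by exact_mod_cast hW) hK (Nat.cast_nonneg _) (Nat.cast_nonneg _)
  have hmn : (A.numStates : ℝ) ^ A.numStates ≤
      A.numTransitions * (A.numStates : ℝ) ^ A.numStates :=
    le_mul_of_one_le_left (by positivity) hm'
  rw [hcard]
  push_cast
  linarith

end WeightedAutomaton

theorem mainTheorem10 :
    ∃ C : ℝ, ∀ (α : Type u) [Finite α] [Nonempty α] (A : WeightedAutomaton.{u, v} α),
      ∃ B : WeightedAutomaton.{u, v} α,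
        B.language limSupValue = (A.language limSupValue).complement ∧
        (B.numStates : ℝ) ≤
          C * ((A.numTransitions : ℝ) *
            (2 : ℝ) ^ ((A.numStates : ℝ) * Real.logb 2 (A.numStates : ℝ))) := by
  obtain ⟨K, -, hK⟩ := exists_ncard_tightRankings_le.{v}
  refine ⟨K + 3, fun α _ _ A => ?_⟩
  have := A.finite_state
  have := A.finite_δ
  have : Nonempty A.State := ⟨A.init⟩
  have : Nonempty A.δ := by
    obtain ⟨q, hq⟩ := A.total A.init (Classical.arbitrary α)
    exact ⟨_, hq⟩
  obtain ⟨t, ht⟩ := Finite.exists_max A.γ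
  refine ⟨A.compl (A.γ t), funext fun w => le_antisymm (A.language_compl_le ht w)
    (A.le_language_compl ht ⟨t, rfl⟩ w), ?_⟩
  have hn : (0 : ℝ) < A.numStates := by exact_mod_cast Nat.card_pos (α := A.State)
  -- The bound `2^(n log n)` is exactly `n^n`; `n > 0` because of the initial state.
  have he : (2 : ℝ) ^ ((A.numStates : ℝ) * Real.logb 2 (A.numStates : ℝ)) =
      (A.numStates : ℝ) ^ A.numStates := by
    rw [mul_comm, Real.rpow_mul (by norm_num), Real.rpow_logb (by norm_num) (by norm_num) hn,
      Real.rpow_natCast]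
  rw [he]
  exact A.numStates_compl_le (hK A.State).2
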